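/- All vector inequalities are componentwise. Let $n\ge 0$. System. Let $X_i=\{x\in\mathbb R^n: E_ix+e_i\ge 0\}$, $i\in I$ ($I$ finite), be polyhedra with pairwise disjoint interiors, and for each $i$ let $x\mapsto A_{ik}x+a_{ik}$, $k\in D_i$, be a nonempty finite family of affine fields. Put $\mathrm{Dom}(P)=\bigcup_i X_i$ and $\Omega_P(x)=\mathrm{co}\{A_{ik}x+a_{ik} : x\in X_i,\ k\in D_i\}$ for $x\in\mathrm{Dom}(P)$. Let $\mathcal A$ be any upper semicontinuous set-valued map on $\mathbb R^n$ with nonempty compact convex values such that $\mathcal A(x)=\Omega_P(x)$ for all $x\in \mathrm{Dom}(P)$ (outside $\mathrm{Dom}(P)$ it is otherwise arbitrary). A solution on $[0,T]$ is an absolutely continuous $x:[0,T]\to\mathbb R^n$ with $\dot x(t)\in\mathcal A(x(t))$ for a.e. $t$; a solution on $[0,\infty)$ is one on every $[0,T]$. Candidate Lyapunov function. Let $Z_j=\{x: F_jx\ge 0\}$, $j\in J$ ($J$ finite), be polyhedral cones that contain no line, have pairwise disjoint interiors and cover $\mathbb R^n$. For $i\ne j$ let $f_{ij}$ be a vector with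 $f_{ij}^Tx=0$ on $Z_i\cap Z_j$. Given vectors $p_j$, let $V(x)=p_j^Tx$ if $x\in Z_j$ (under the constraints below this does not depend on the choice of $j$). Let $I_{cont}$ be the set of pairs $(i,j)$, $i\neq j$, such that $Z_i\cap Z_j$ contains a nonzero point, and $I_{dec}$ the set of triples $(i,j,k)$, $k\in D_i$, such that $X_i\cap Z_j$ contains a nonzero point. Level sets. Let $L$ be the set of $c>0$ with $\{V=c\}\subseteq\mathrm{Dom}(P)$. Let $S_{min}=\bigcap_{c\in L}\{V\le c\}$, and let $S_{max}$ be the union of the sets $\{V\le c\}$ over those $c\in L$ for which $[b,c]\subseteq L$ for every $b\in L$ with $b\le c$. (If $L$ is an interval, these are the regions bounded by the largest and by the smallest level set of $V$ in $\mathrm{Dom}(P)$.) Lemma. Let $\mathrm{Dom}(P)$ be connected and let $0\in\mathrm{co}(\mathrm{Dom}(P))$. Suppose that there are vectors $\mu_j$, $v_{ijk}$ and reals $\lambda_{ij}$ such that $$p_j=F_j^T\mu_j,\quad \mu_j\ge\mathbf 1\qquad (j\in J),$$ $$\begin{bmatrix}E_i&e_i\\0&1\end{bmatrix}^Tv_{ijk}=-\begin{bmatrix}A_{ik}^T\\a_{ik}^T\end{bmatrix}p_j,\quad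 v_{ijk}\ge\mathbf 1\qquad ((i,j,k)\in I_{dec}),$$ $$p_i-p_j=\lambda_{ij}f_{ij},\quad \lambda_{ij}\ge 1\qquad((i,j)\in I_{cont}).$$ Then: 1. $S_{max}$ is invariant: every solution on some $[0,T]$ that starts in $S_{max}$ stays in $S_{max}$. 2. $S_{min}$ is an ultimate bound: for every bounded $B\subseteq S_{max}$ there is $\tau\ge 0$ such that every solution on some $[0,T]$ that starts in $B$ satisfies $x(t)\in S_{min}$ for all $t\in[\tau,T]$. 3. If moreover $0$ is an interior point of $\mathrm{Dom}(P)$, then the origin is asymptotically stable with region of attraction containing $S_{max}$: $0\in\mathcal A(0)$; for every neighbourhood $U$ of $0$ there is a neighbourhood $W$ of $0$ such that solutions that start in $W$ stay in $U$; $S_{max}$ is a neighbourhood of $0$; and every solution on $[0,\infty)$ that starts in $S_{max}$ converges to $0$. -/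

import Mathlib

open Set Filter Topology MeasureTheory
open scoped Matrix

namespace PWA

/-- The closed convex polyhedron `{x | E x + e ≥ 0}` (componentwise inequality). -/
def polyhedron {r n : ℕ} (E : Matrix (Fin r) (Fin n) ℝ) (e : Fin r → ℝ) : Set (Fin n → ℝ) :=
  {x | 0 ≤ E *ᵥ x + e}

/-- A piecewise affine differential inclusion on `ℝⁿ`: finitely many polyhedral cells
`X i = {x | E i x + e i ≥ 0}` with pairwise disjoint interiors, and, for each cell, a nonempty
finite family of affine vector fields `x ↦ A i k x + a i k`. The cells need not cover `ℝⁿ`. -/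
structure System (n : ℕ) (ι : Type*) where
  rows : ι → ℕ
  E : ∀ i, Matrix (Fin (rows i)) (Fin n) ℝ
  e : ∀ i, Fin (rows i) → ℝ
  numFields : ι → ℕ
  numFields_pos : ∀ i, 0 < numFields i
  A : ∀ i, Fin (numFields i) → Matrix (Fin n) (Fin n) ℝ
  a : ∀ i, Fin (numFields i) → Fin n → ℝ
  disjoint_interior : ∀ i j, i ≠ j →
    Disjoint (interior (polyhedron (E i) (e i))) (interior (polyhedron (E j) (e j)))

namespace System

variable {n : ℕ} {ι : Type*} (Ω : System n ι)

/-- The cell with index `i`. -/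
def cell (i : ι) : Set (Fin n → ℝ) := polyhedron (Ω.E i) (Ω.e i)

/-- The domain: the union of the cells. -/
def Dom : Set (Fin n → ℝ) := ⋃ i, Ω.cell i

/-- The set of admissible velocities at `x`: the convex hull of the values at `x` of all affine
fields attached to cells that contain `x`. In a point that lies in a single cell `i` this is the
convex hull of the `A i k x + a i k`; where cells meet, it is the usual convexification. -/
def velocities (x : Fin n → ℝ) : Set (Fin n → ℝ) :=
  convexHull ℝ {v | ∃ i, x ∈ Ω.cell i ∧ ∃ k, v = Ω.A i k *ᵥ x + Ω.a i k}

end System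

/-- A finite polyhedral conic partition of `ℝⁿ`: the closed cones `Z j = {x | F j x ≥ 0}` have
pairwise disjoint interiors, contain no line and cover `ℝⁿ`; `f i j` is a normal vector of a
hyperplane through the origin that contains `Z i ∩ Z j`. -/
structure ConePartition (n : ℕ) (κ : Type*) where
  rows : κ → ℕ
  F : ∀ j, Matrix (Fin (rows j)) (Fin n) ℝ
  disjoint_interior : ∀ i j, i ≠ j →
    Disjoint (interior {x | 0 ≤ F i *ᵥ x}) (interior {x | 0 ≤ F j *ᵥ x})
  pointed : ∀ j x, 0 ≤ F j *ᵥ x → 0 ≤ F j *ᵥ (-x) → x = 0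
  cover : ∀ x, ∃ j, 0 ≤ F j *ᵥ x
  f : κ → κ → Fin n → ℝ
  f_orthogonal : ∀ i j, i ≠ j → ∀ x, 0 ≤ F i *ᵥ x → 0 ≤ F j *ᵥ x → f i j ⬝ᵥ x = 0

namespace ConePartition

variable {n : ℕ} {κ : Type*} (Q : ConePartition n κ)

/-- The cone with index `j`. -/
def cone (j : κ) : Set (Fin n → ℝ) := {x | 0 ≤ Q.F j *ᵥ x}

/-- The candidate Lyapunov function `V x = p jᵀ x` for `x` in the cone `j`. (If several cones
contain `x`, one of them is chosen; `lyap_eq` below shows that the choice does not matter under the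
constraints.) -/
noncomputable def lyap (p : κ → Fin n → ℝ) (x : Fin n → ℝ) : ℝ :=
  p (Q.cover x).choose ⬝ᵥ x

end ConePartition

section Constraints

variable {n : ℕ} {ι κ : Type*}

/-- The pairs of distinct cones that share a point other than the common apex `0`. -/
def Icont (Q : ConePartition n κ) : Set (κ × κ) :=
  {q | q.1 ≠ q.2 ∧ ∃ x, x ≠ 0 ∧ x ∈ Q.cone q.1 ∧ x ∈ Q.cone q.2}

/-- The pairs of a cell and a cone that share a point other than the apex `0` of the cones. -/
def Idec (Ω : System n ι) (Q : ConePartition n κ) : Set (ι × κ) :=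
  {q | ∃ x, x ≠ 0 ∧ x ∈ Ω.cell q.1 ∧ x ∈ Q.cone q.2}

/-- The constraint system for the vectors `p j` is feasible: there are multipliers `μ`, `v`, `lam`
with which all constraints hold. -/
def Feasible (Ω : System n ι) (Q : ConePartition n κ) (p : κ → Fin n → ℝ) : Prop :=
  ∃ (μ : ∀ j, Fin (Q.rows j) → ℝ)
    (v : ∀ (i : ι) (_ : κ) (_ : Fin (Ω.numFields i)), Fin (Ω.rows i) ⊕ Unit → ℝ)
    (lam : κ → κ → ℝ),
    (∀ j, p j = (Q.F j)ᵀ *ᵥ μ j) ∧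
    (∀ j, 1 ≤ μ j) ∧
    (∀ i j, (i, j) ∈ Idec Ω Q → ∀ k,
      (Matrix.fromBlocks (Ω.E i) (Matrix.replicateCol Unit (Ω.e i)) 0 1)ᵀ *ᵥ v i j k =
        -(Matrix.fromRows (Ω.A i k)ᵀ (Matrix.replicateRow Unit (Ω.a i k)) *ᵥ p j)) ∧
    (∀ i j, (i, j) ∈ Idec Ω Q → ∀ k, 1 ≤ v i j k) ∧
    (∀ i j, (i, j) ∈ Icont Q → p i - p j = lam i j • Q.f i j) ∧
    (∀ i j, (i, j) ∈ Icont Q → 1 ≤ lam i j)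

/-- Under the constraints, `V x = p jᵀ x` for every cone `j` that contains `x`. -/
theorem lyap_eq {Ω : System n ι} {Q : ConePartition n κ} {p : κ → Fin n → ℝ}
    (h : Feasible Ω Q p) {j : κ} {x : Fin n → ℝ} (hx : x ∈ Q.cone j) :
    Q.lyap p x = p j ⬝ᵥ x := by
  obtain ⟨μ, v, lam, -, -, -, -, hc, -⟩ := h
  unfold ConePartition.lyap
  have hi := (Q.cover x).choose_spec
  set i := (Q.cover x).choose
  by_cases hij : i = j
  · rw [hij]
  by_cases h0 : x = 0
  · simp [h0]
  have h1 := hc i j ⟨hij, x, h0, hi, hx⟩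
  have h2 := Q.f_orthogonal i j hij x hi hx
  have h3 : (p i - p j) ⬝ᵥ x = 0 := by rw [h1, smul_dotProduct, h2, smul_zero]
  rw [sub_dotProduct] at h3
  linarith

/-- The positive levels `c` of `V` such that the level set `{V = c}` lies in the domain. -/
def levels (Ω : System n ι) (Q : ConePartition n κ) (p : κ → Fin n → ℝ) : Set ℝ :=
  {c | 0 < c ∧ {x | Q.lyap p x = c} ⊆ Ω.Dom}

/-- The region `S_min` bounded by the smallest level set of `V` in the domain: the intersection of
all `{V ≤ c}` with `c` a level in the domain. It is `{0}` if all small levels are in the domain. -/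
def Smin (Ω : System n ι) (Q : ConePartition n κ) (p : κ → Fin n → ℝ) : Set (Fin n → ℝ) :=
  {x | ∀ c ∈ levels Ω Q p, Q.lyap p x ≤ c}

/-- The region `S_max` bounded by the largest level set of `V` in the domain: the union of the sets
`{V ≤ c}` with `c` a level in the domain such that there is no gap below `c`, i.e. all values
between a smaller level in the domain and `c` are also levels in the domain. (It is everything if
arbitrarily large `c` qualify.) -/
def Smax (Ω : System n ι) (Q : ConePartition n κ) (p : κ → Fin n → ℝ) : Set (Fin n → ℝ) :=
  {x | ∃ c ∈ levels Ω Q p, Q.lyap p x ≤ c ∧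
    ∀ b ∈ levels Ω Q p, b ≤ c → Icc b c ⊆ levels Ω Q p}

end Constraints

section Inclusions

variable {n : ℕ}

/-- The standing regularity of a differential inclusion on `ℝⁿ`: the right-hand side is upper
semicontinuous (as a set-valued map) with nonempty compact convex values. -/
structure IsRegularInclusion (𝒜 : (Fin n → ℝ) → Set (Fin n → ℝ)) : Prop where
  nonempty : ∀ x, (𝒜 x).Nonempty
  isCompact : ∀ x, IsCompact (𝒜 x)
  convex : ∀ x, Convex ℝ (𝒜 x)
  usc : UpperHemicontinuous 𝒜

/-- A Caratheodory solution of `x' ∈ 𝒜 x` on `[0, T]`. -/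
def IsSolution (𝒜 : (Fin n → ℝ) → Set (Fin n → ℝ)) (x : ℝ → Fin n → ℝ) (T : ℝ) : Prop :=
  AbsolutelyContinuousOnInterval x 0 T ∧
    ∀ᵐ t ∂(volume : Measure ℝ), t ∈ Ioo 0 T → ∃ v ∈ 𝒜 (x t), HasDerivAt x v t

/-- `S` is (strongly, forward) invariant: solutions that start in `S` stay in `S`. -/
def IsInvariant (𝒜 : (Fin n → ℝ) → Set (Fin n → ℝ)) (S : Set (Fin n → ℝ)) : Prop :=
  ∀ T, 0 ≤ T → ∀ x, IsSolution 𝒜 x T → x 0 ∈ S → ∀ t ∈ Icc 0 T, x t ∈ S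

/-- Solutions from `S` are ultimately bounded by `M`: for every bounded set `B ⊆ S` there is a
time after which all solutions that started in `B` are in `M`. -/
def IsUltimatelyBounded (𝒜 : (Fin n → ℝ) → Set (Fin n → ℝ)) (S M : Set (Fin n → ℝ)) : Prop :=
  ∀ B ⊆ S, Bornology.IsBounded B → ∃ τ : ℝ, 0 ≤ τ ∧
    ∀ T, 0 ≤ T → ∀ x, IsSolution 𝒜 x T → x 0 ∈ B → ∀ t ∈ Icc τ T, x t ∈ M

/-- The point `z` is an asymptotically stable equilibrium of `x' ∈ 𝒜 x` whose region of attraction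
contains the neighbourhood `S` of `z`. -/
structure IsAsymptoticallyStable (𝒜 : (Fin n → ℝ) → Set (Fin n → ℝ)) (z : Fin n → ℝ)
    (S : Set (Fin n → ℝ)) : Prop where
  equilibrium : 0 ∈ 𝒜 z
  stable : ∀ U ∈ 𝓝 z, ∃ W ∈ 𝓝 z, ∀ T, 0 ≤ T → ∀ x, IsSolution 𝒜 x T → x 0 ∈ W →
    ∀ t ∈ Icc 0 T, x t ∈ U
  mem_nhds : S ∈ 𝓝 z
  attractive : ∀ x : ℝ → Fin n → ℝ, (∀ T, 0 ≤ T → IsSolution 𝒜 x T) → x 0 ∈ S →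
    Tendsto x atTop (𝓝 z)

end Inclusions

end PWA

namespace PWA

/-! `V` is continuous, piecewise linear, positively homogeneous and positive away from 0. Pairing
the decrease constraint with `(x, 1)` gives `p j ⬝ᵥ w ≤ -1` for every admissible velocity `w` at a
nonzero point of the domain and every linear piece active there. Along a solution `V` is absolutely
continuous, so such bounds integrate even though `V` is not differentiable.

If `{V = c}` lies in the domain, upper semicontinuity extends strict decrease to a neighbourhood of
each of its points, even outside the domain, so no solution leaves `{V ≤ c}`. Between two levels
without a gap `V` falls at rate at least 1, so the lower one is reached within a time bounded by the
initial value of `V`. If the origin is interior to the domain, all small levels are available and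
the origin itself is reached in finite time. -/

/-- A real function with the pointwise estimate `f y - f x ≤ K * dist y x` near every point `x` of
a normed space is Lipschitz with constant `K`. -/
theorem lipschitzWith_of_eventually_sub_le {E : Type*} [NormedAddCommGroup E] [NormedSpace ℝ E]
    {f : E → ℝ} {K : NNReal} (hf : Continuous f)
    (h : ∀ x, ∀ᶠ y in 𝓝 x, f y - f x ≤ K * dist y x) : LipschitzWith K f := by
  refine LipschitzWith.of_le_add_mul K fun y x => ?_
  set γ : ℝ → E := fun t => x + t • (y - x) with hγ
  have hγc : Continuous γ := by fun_prop
  have key : ∀ ⦃t⦄, t ∈ Icc (0 : ℝ) 1 → f (γ t) ≤ f x + K * dist y x * t := by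
    -- The local one-sided estimate bounds the right slopes along the segment from `x` to `y`; the
    -- fencing inequality turns this into a global bound.
    refine image_le_of_liminf_slope_right_le_deriv_boundary (B' := fun _ => K * dist y x)
      (hf.comp hγc).continuousOn (by simp [hγ]) (by fun_prop) (fun t _ => ?_) (fun t _ r hr => ?_)
    · simpa using (((hasDerivAt_id t).const_mul (K * dist y x)).const_add (f x)).hasDerivWithinAt
    · refine Eventually.frequently ?_
      filter_upwards [nhdsWithin_le_nhds (hγc.continuousAt.eventually (h (γ t))),
        self_mem_nhdsWithin] with s hs hts
      have hts' : 0 < s - t := sub_pos.2 hts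
      have hd : dist (γ s) (γ t) = (s - t) * dist y x := by
        have : γ s - γ t = (s - t) • (y - x) := by simp only [hγ, sub_smul]; abel
        rw [dist_eq_norm, this, norm_smul, Real.norm_of_nonneg hts'.le, dist_eq_norm]
      rw [hd] at hs
      rw [slope_def_field, div_lt_iff₀ hts']
      simp only [Function.comp]
      nlinarith
  simpa [hγ] using key (right_mem_Icc.2 zero_le_one)

section Lyapunov

variable {n : ℕ} {ι κ : Type*} {Ω : System n ι} {Q : ConePartition n κ} {p : κ → Fin n → ℝ}

/-! ### Geometry of the cones and of `V` -/

namespace ConePartition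

theorem isClosed_cone (Q : ConePartition n κ) (j : κ) : IsClosed (Q.cone j) := by
  have : Continuous fun x => Q.F j *ᵥ x := by fun_prop
  exact isClosed_le continuous_const this

theorem exists_mem_cone (Q : ConePartition n κ) (x : Fin n → ℝ) : ∃ j, x ∈ Q.cone j :=
  Q.cover x

theorem smul_mem_cone {j : κ} {x : Fin n → ℝ} (hx : x ∈ Q.cone j) {c : ℝ} (hc : 0 ≤ c) :
    c • x ∈ Q.cone j := by
  simp only [cone, mem_ofPred_eq, Matrix.mulVec_smul] at hx ⊢
  exact smul_nonneg hc hx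

theorem eventually_mem_cone_imp [Finite κ] (Q : ConePartition n κ) (x : Fin n → ℝ) :
    ∀ᶠ y in 𝓝 x, ∀ j, y ∈ Q.cone j → x ∈ Q.cone j := by
  refine eventually_all.2 fun j => ?_
  by_cases hx : x ∈ Q.cone j
  · exact .of_forall fun _ _ => hx
  · filter_upwards [(Q.isClosed_cone j).isOpen_compl.mem_nhds hx] with y hy hy'
    exact absurd hy' hy

end ConePartition

theorem Feasible.lyap_zero (h : Feasible Ω Q p) : Q.lyap p 0 = 0 := by
  obtain ⟨j, hj⟩ := Q.exists_mem_cone 0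
  simp [lyap_eq h hj]

theorem Feasible.lyap_smul (h : Feasible Ω Q p) {c : ℝ} (hc : 0 ≤ c) (x : Fin n → ℝ) :
    Q.lyap p (c • x) = c * Q.lyap p x := by
  obtain ⟨j, hj⟩ := Q.exists_mem_cone x
  rw [lyap_eq h hj, lyap_eq h (Q.smul_mem_cone hj hc), dotProduct_smul, smul_eq_mul]

/-- `V x` is the sum of the entries of `F j x ≥ 0` with weights `μ j ≥ 1`; if it vanished, `F j x =
0` and the cone would contain the line through `x`. -/
theorem Feasible.lyap_pos (h : Feasible Ω Q p) {x : Fin n → ℝ} (hx : x ≠ 0) :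
    0 < Q.lyap p x := by
  obtain ⟨j, hj⟩ := Q.exists_mem_cone x
  rw [lyap_eq h hj]
  obtain ⟨μ, -, -, hp, hμ, -⟩ := h
  have hj' : ∀ r, 0 ≤ (Q.F j *ᵥ x) r := hj
  have hsum : p j ⬝ᵥ x = ∑ r, μ j r * (Q.F j *ᵥ x) r := by
    rw [hp j, Matrix.mulVec_transpose, ← Matrix.dotProduct_mulVec]; rfl
  rw [hsum]
  refine Finset.sum_pos' (fun r _ => mul_nonneg (zero_le_one.trans (hμ j r)) (hj' r)) ?_
  by_contra! hc
  refine hx (Q.pointed j x hj ?_)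
  rw [Matrix.mulVec_neg]
  intro r
  have h1 := hc r (Finset.mem_univ r)
  have h2 := hj' r
  have h3 : 1 ≤ μ j r := hμ j r
  simp only [Pi.zero_apply, Pi.neg_apply]
  nlinarith

/-- Near `x`, the increment of `V` is that of a linear piece that is active at `x`. -/
theorem Feasible.eventually_lyap_sub (h : Feasible Ω Q p) [Finite κ] (x : Fin n → ℝ) :
    ∀ᶠ y in 𝓝 x, ∃ j, x ∈ Q.cone j ∧ Q.lyap p y - Q.lyap p x = p j ⬝ᵥ (y - x) := by
  filter_upwards [Q.eventually_mem_cone_imp x] with y hy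
  obtain ⟨j, hj⟩ := Q.exists_mem_cone y
  exact ⟨j, hy j hj, by rw [lyap_eq h hj, lyap_eq h (hy j hj), dotProduct_sub]⟩

theorem abs_dotProduct_le (u v : Fin n → ℝ) : |u ⬝ᵥ v| ≤ (∑ r, |u r|) * ‖v‖ := by
  rw [Finset.sum_mul]
  refine (Finset.abs_sum_le_sum_abs _ _).trans (Finset.sum_le_sum fun r _ => ?_)
  rw [abs_mul]
  exact mul_le_mul_of_nonneg_left (norm_le_pi_norm v r) (abs_nonneg _)

theorem Feasible.exists_lipschitzWith_lyap (h : Feasible Ω Q p) [Finite κ] :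
    ∃ K, LipschitzWith K (Q.lyap p) := by
  have := Fintype.ofFinite κ
  set C : ℝ := ∑ j, ∑ r, |p j r| with hC
  have hC0 : 0 ≤ C := by positivity
  have hb : ∀ x, ∀ᶠ y in 𝓝 x, |Q.lyap p y - Q.lyap p x| ≤ C * dist y x := fun x => by
    filter_upwards [h.eventually_lyap_sub x] with y ⟨j, _, hj⟩
    rw [hj, dist_eq_norm]
    refine (abs_dotProduct_le _ _).trans (mul_le_mul_of_nonneg_right ?_ (norm_nonneg _))
    exact Finset.single_le_sum (f := fun j => ∑ r, |p j r|) (fun _ _ => by positivity)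
      (Finset.mem_univ j)
  have hcont : Continuous (Q.lyap p) := by
    refine continuous_iff_continuousAt.2 fun x => ?_
    rw [ContinuousAt, tendsto_iff_dist_tendsto_zero]
    refine squeeze_zero' (.of_forall fun _ => dist_nonneg) (g := fun y => C * dist y x) ?_ ?_
    · simpa only [Real.dist_eq] using hb x
    · have : Continuous fun y => C * dist y x := by fun_prop
      simpa using this.tendsto x
  refine ⟨⟨C, hC0⟩, lipschitzWith_of_eventually_sub_le hcont fun x => ?_⟩
  filter_upwards [hb x] with y hy using (le_abs_self _).trans hy

theorem Feasible.continuous_lyap (h : Feasible Ω Q p) [Finite κ] : Continuous (Q.lyap p) :=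
  h.exists_lipschitzWith_lyap.choose_spec.continuous

/-- Positivity on the compact unit sphere, spread by homogeneity; this makes sublevel sets bounded.
-/
theorem Feasible.exists_mul_norm_le_lyap (h : Feasible Ω Q p) [Finite κ] :
    ∃ α > 0, ∀ x, α * ‖x‖ ≤ Q.lyap p x := by
  obtain ⟨α, hα, hle⟩ := (isCompact_sphere (0 : Fin n → ℝ) 1).exists_forall_le'
    h.continuous_lyap.continuousOn (a := 0)
    (fun x hx => h.lyap_pos (ne_zero_of_mem_unit_sphere ⟨x, hx⟩))
  refine ⟨α, hα, fun x => ?_⟩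
  rcases eq_or_ne x 0 with rfl | hx
  · simp [h.lyap_zero]
  have hn : 0 < ‖x‖ := norm_pos_iff.2 hx
  have h1 := hle (‖x‖⁻¹ • x) (by simp [norm_smul, hn.ne'])
  rw [h.lyap_smul (inv_nonneg.2 hn.le), inv_mul_eq_div, le_div_iff₀ hn] at h1
  exact h1

theorem Feasible.sublevel_subset_closedBall (h : Feasible Ω Q p) [Finite κ] :
    ∃ α > 0, ∀ c, {x | Q.lyap p x ≤ c} ⊆ Metric.closedBall 0 (c / α) := by
  obtain ⟨α, hα, hle⟩ := h.exists_mul_norm_le_lyap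
  refine ⟨α, hα, fun c x hx => ?_⟩
  rw [mem_closedBall_zero_iff, le_div_iff₀ hα, mul_comm]
  exact (hle x).trans hx

theorem Feasible.exists_sublevel_subset (h : Feasible Ω Q p) [Finite κ] {U : Set (Fin n → ℝ)}
    (hU : U ∈ 𝓝 0) : ∃ c > 0, {x | Q.lyap p x ≤ c} ⊆ U := by
  obtain ⟨α, hα, hsub⟩ := h.sublevel_subset_closedBall
  obtain ⟨ε, hε, hball⟩ := Metric.nhds_basis_closedBall.mem_iff.1 hU
  refine ⟨ε * α, by positivity, (hsub _).trans ?_⟩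
  rwa [mul_div_cancel_right₀ _ hα.ne']

theorem Feasible.sublevel_mem_nhds (h : Feasible Ω Q p) [Finite κ] {c : ℝ} (hc : 0 < c) :
    {x | Q.lyap p x ≤ c} ∈ 𝓝 0 := by
  have := h.continuous_lyap.continuousAt.eventually_lt (continuousAt_const (y := c))
    (x₀ := 0) (by rwa [h.lyap_zero])
  filter_upwards [this] with x hx using hx.le

/-! ### Decrease of `V` along solutions -/

/-- Every linear piece of `V` that is active at a nonzero point decreases at rate at
least one along every admissible velocity. -/
theorem Feasible.dotProduct_velocity_le (h : Feasible Ω Q p) {x w : Fin n → ℝ}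
    (hx0 : x ≠ 0) {j : κ} (hj : x ∈ Q.cone j) (hw : w ∈ Ω.velocities x) : p j ⬝ᵥ w ≤ -1 := by
  obtain ⟨-, v, -, -, -, hdec, hv, -⟩ := h
  have hconv : Convex ℝ {w : Fin n → ℝ | p j ⬝ᵥ w ≤ -1} :=
    convex_halfSpace_le ⟨dotProduct_add _, fun c w => dotProduct_smul c _ w⟩ _
  refine convexHull_min ?_ hconv hw
  rintro _ ⟨i, hi, k, rfl⟩
  have hij : (i, j) ∈ Idec Ω Q := ⟨x, hx0, hi, hj⟩
  -- Pairing with `(x, 1)` yields `p j ⬝ᵥ (A x + a) = -(∑ v r * (E x + e) r + v last)`. The sum is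
  -- nonnegative on the cell, and the entry of `v` for the extra row `(0 1)` supplies the rate 1.
  have h1 := congrArg (fun u => u ⬝ᵥ Sum.elim x (fun _ : Unit => (1 : ℝ))) (hdec i j hij k)
  have hv' := hv i j hij k
  simp only [Matrix.mulVec_transpose, ← Matrix.dotProduct_mulVec, neg_dotProduct,
    Matrix.fromBlocks_mulVec, Matrix.fromRows_mulVec] at h1
  have hcol : Matrix.replicateCol Unit (Ω.e i) *ᵥ (fun _ : Unit => (1 : ℝ)) = Ω.e i := by
    ext r
    simp [Matrix.mulVec, dotProduct]
  have hrow : Matrix.replicateRow Unit (Ω.a i k) *ᵥ p j = fun _ => Ω.a i k ⬝ᵥ p j := rfl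
  rw [Sum.elim_comp_inl, Sum.elim_comp_inr, hcol, hrow, Matrix.zero_mulVec, Matrix.one_mulVec,
    zero_add, sumElim_dotProduct_sumElim, ← Matrix.dotProduct_mulVec, dotProduct_comm (Ω.a i k)]
    at h1
  have hsplit : v i j k ⬝ᵥ Sum.elim (Ω.E i *ᵥ x + Ω.e i) (fun _ => 1) =
      (∑ r, v i j k (Sum.inl r) * (Ω.E i *ᵥ x + Ω.e i) r) + v i j k (Sum.inr ()) := by
    simp [dotProduct]
  have hsum : 0 ≤ ∑ r, v i j k (Sum.inl r) * (Ω.E i *ᵥ x + Ω.e i) r :=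
    Finset.sum_nonneg fun r _ => mul_nonneg (zero_le_one.trans (hv' _)) (hi r)
  have hlast : 1 ≤ v i j k (Sum.inr ()) := hv' _
  have hone : p j ⬝ᵥ Ω.a i k = (fun _ : Unit => p j ⬝ᵥ Ω.a i k) ⬝ᵥ fun _ => (1 : ℝ) := by
    simp [dotProduct]
  rw [mem_ofPred_eq, dotProduct_add, hone]
  linarith

/-- Each right difference quotient of `V ∘ x` near `t` is `p j ⬝ᵥ slope x t s` for some piece `j`
active at `x t`. The piece may vary with `s`, but there are finitely many, and each such quotient
tends to `p j ⬝ᵥ w ≤ δ`. -/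
theorem deriv_lyap_comp_le (h : Feasible Ω Q p) [Finite κ] {x : ℝ → Fin n → ℝ} {w : Fin n → ℝ}
    {t δ : ℝ} (hx : HasDerivAt x w t) (hd : DifferentiableAt ℝ (fun s => Q.lyap p (x s)) t)
    (hδ : ∀ j, x t ∈ Q.cone j → p j ⬝ᵥ w ≤ δ) : deriv (fun s => Q.lyap p (x s)) t ≤ δ := by
  refine le_of_forall_pos_le_add fun ε hε => ?_
  have h1 : Tendsto (slope (fun s => Q.lyap p (x s)) t) (𝓝[>] t) (𝓝 (deriv _ t)) :=
    (hasDerivAt_iff_tendsto_slope.1 hd.hasDerivAt).mono_left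
      (nhdsWithin_mono _ fun s hs => ne_of_gt hs)
  have h2 : Tendsto (slope x t) (𝓝[>] t) (𝓝 w) :=
    (hasDerivAt_iff_tendsto_slope.1 hx).mono_left (nhdsWithin_mono _ fun s hs => ne_of_gt hs)
  have h3 : ∀ᶠ s in 𝓝[>] t, ∀ j, x t ∈ Q.cone j → p j ⬝ᵥ slope x t s < δ + ε := by
    refine eventually_all.2 fun j => ?_
    by_cases hj : x t ∈ Q.cone j
    · have hc : Continuous fun u : Fin n → ℝ => p j ⬝ᵥ u := by fun_prop
      have := ((hc.tendsto w).comp h2).eventually_lt_const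
        ((hδ j hj).trans_lt (lt_add_of_pos_right δ hε))
      filter_upwards [this] with s hs _ using hs
    · exact .of_forall fun _ hj' => absurd hj' hj
  refine le_of_tendsto h1 ?_
  filter_upwards [h3, nhdsWithin_le_nhds (hx.continuousAt.eventually (h.eventually_lyap_sub (x t)))]
    with s hs ⟨j, hj, hjs⟩
  rw [slope_def_field, hjs, div_eq_inv_mul, ← smul_eq_mul, ← dotProduct_smul]
  exact (hs j hj).le

variable {𝒜 : (Fin n → ℝ) → Set (Fin n → ℝ)} {x : ℝ → Fin n → ℝ} {T : ℝ}

/-- Integrated decrease of `V` along a solution. -/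
theorem Feasible.lyap_le_of_dotProduct_le (h : Feasible Ω Q p) [Finite κ]
    (hx : IsSolution 𝒜 x T) {a b δ : ℝ} (ha : 0 ≤ a) (hab : a ≤ b) (hb : b ≤ T)
    (hδ : ∀ t ∈ Ioo a b, ∀ w ∈ 𝒜 (x t), ∀ j, x t ∈ Q.cone j → p j ⬝ᵥ w ≤ δ) :
    Q.lyap p (x b) ≤ Q.lyap p (x a) + δ * (b - a) := by
  obtain ⟨K, hK⟩ := h.exists_lipschitzWith_lyap
  have hg : AbsolutelyContinuousOnInterval (fun t => Q.lyap p (x t)) a b := by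
    have hx' := hx.1.mono (c := a) (d := b)
      (by rw [uIcc_of_le hab, uIcc_of_le (ha.trans (hab.trans hb))]; exact Icc_subset_Icc ha hb)
    refine squeeze_zero (fun _ => Finset.sum_nonneg fun _ _ => dist_nonneg) (fun E => ?_)
      (by simpa using Tendsto.const_mul (K : ℝ) hx')
    rw [Finset.mul_sum]
    exact Finset.sum_le_sum fun _ _ => hK.dist_le_mul _ _
  have hint := hg.integral_deriv_eq_sub
  have hle : ∫ t in a..b, deriv (fun t => Q.lyap p (x t)) t ≤ ∫ _ in a..b, δ := by
    refine intervalIntegral.integral_mono_ae_restrict hab hg.intervalIntegrable_deriv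
      intervalIntegrable_const ?_
    rw [← Measure.restrict_congr_set Ioo_ae_eq_Icc]
    refine (ae_restrict_iff' measurableSet_Ioo).2 ?_
    filter_upwards [hg.ae_differentiableAt, hx.2] with t hd hs ht
    obtain ⟨w, hw, hder⟩ := hs ⟨ha.trans_lt ht.1, ht.2.trans_le hb⟩
    exact deriv_lyap_comp_le h hder (hd (by rw [uIcc_of_le hab]; exact Ioo_subset_Icc_self ht))
      (hδ t ht w hw)
  rw [hint, intervalIntegral.integral_const, smul_eq_mul] at hle
  linarith

theorem Feasible.ne_zero_of_lyap_pos (h : Feasible Ω Q p) {y : Fin n → ℝ}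
    (hy : 0 < Q.lyap p y) : y ≠ 0 := by
  rintro rfl
  exact hy.ne' h.lyap_zero

/-- Negativity on the finitely many active pieces is an open condition on velocities, so upper
semicontinuity carries it to points near `y`, including those outside the domain, where nothing else
is known about `𝒜`. -/
theorem Feasible.eventually_dotProduct_neg (h : Feasible Ω Q p) [Finite κ]
    (hreg : IsRegularInclusion 𝒜) (hΩ : ∀ x ∈ Ω.Dom, 𝒜 x = Ω.velocities x)
    {y : Fin n → ℝ} (hy : Q.lyap p y ∈ levels Ω Q p) :
    ∀ᶠ z in 𝓝 y, ∀ w ∈ 𝒜 z, ∀ j, z ∈ Q.cone j → p j ⬝ᵥ w < 0 := by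
  have hyD : y ∈ Ω.Dom := hy.2 rfl
  have hopen : IsOpen {w : Fin n → ℝ | ∀ j, y ∈ Q.cone j → p j ⬝ᵥ w < 0} := by
    simp only [ofPred_forall]
    refine isOpen_iInter_of_finite fun j => isOpen_iInter_of_finite fun _ => ?_
    exact isOpen_lt (by fun_prop) continuous_const
  have hsub : 𝒜 y ⊆ {w : Fin n → ℝ | ∀ j, y ∈ Q.cone j → p j ⬝ᵥ w < 0} := fun w hw j hj => by
    rw [hΩ y hyD] at hw
    linarith [h.dotProduct_velocity_le (h.ne_zero_of_lyap_pos hy.1) hj hw]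
  filter_upwards [hreg.usc.forall_isOpen y _ hopen hsub, Q.eventually_mem_cone_imp y]
    with z hz hz' w hw j hj using hz hw j (hz' j hj)

/-! ### Invariance and ultimate bound -/

/-- The sublevel sets of `V` for levels in the domain are forward invariant. -/
theorem Feasible.lyap_le_of_mem_levels (h : Feasible Ω Q p) [Finite κ]
    (hreg : IsRegularInclusion 𝒜) (hΩ : ∀ x ∈ Ω.Dom, 𝒜 x = Ω.velocities x)
    (hx : IsSolution 𝒜 x T) {c : ℝ} (hc : c ∈ levels Ω Q p) {s t : ℝ} (hs : 0 ≤ s) (hst : s ≤ t)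
    (ht : t ≤ T) (hxs : Q.lyap p (x s) ≤ c) : Q.lyap p (x t) ≤ c := by
  have hxc : ContinuousOn x (Icc s t) := by
    refine hx.1.continuousOn.mono ?_
    rw [uIcc_of_le (hs.trans (hst.trans ht))]
    exact Icc_subset_Icc hs ht
  have hcl : IsClosed ({r | Q.lyap p (x r) ≤ c} ∩ Icc s t) := by
    rw [inter_comm]
    exact (h.continuous_lyap.comp_continuousOn hxc).preimage_isClosed_of_isClosed isClosed_Icc
      isClosed_Iic
  refine hcl.Icc_subset_of_forall_mem_nhdsWithin hxs (fun r hr => ?_) (right_mem_Icc.2 hst)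
  have hrI : Icc r t ⊆ Icc s t := Icc_subset_Icc_left hr.2.1
  have hxr : Tendsto x (𝓝[>] r) (𝓝 (x r)) := by
    have := (hxc r (Ico_subset_Icc_self hr.2)).mono hrI
    exact this.mono_left (nhdsWithin_le_of_mem (Icc_mem_nhdsGT hr.2.2))
  rcases (show Q.lyap p (x r) ≤ c from hr.1).lt_or_eq with hlt | heq
  · filter_upwards [((h.continuous_lyap.tendsto _).comp hxr).eventually_lt_const hlt] with q hq
      using le_of_lt hq
  · have hev := hxr.eventually (h.eventually_dotProduct_neg hreg hΩ (y := x r) (heq ▸ hc))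
    obtain ⟨u, hu, hsub⟩ := (mem_nhdsGT_iff_exists_Ioo_subset' hr.2.2).1 hev
    filter_upwards [Ioo_mem_nhdsGT (lt_min hu hr.2.2)] with q hq
    have := h.lyap_le_of_dotProduct_le hx (hs.trans hr.2.1) hq.1.le
      ((hq.2.trans_le (min_le_right _ _)).le.trans ht) (δ := 0) fun τ hτ w hw j hj =>
        (hsub ⟨hτ.1, hτ.2.trans (hq.2.trans_le (min_le_left _ _))⟩ w hw j hj).le
    rw [zero_mul, add_zero] at this
    exact this.trans heq.le

theorem Feasible.isInvariant_Smax (h : Feasible Ω Q p) [Finite κ]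
    (hreg : IsRegularInclusion 𝒜) (hΩ : ∀ x ∈ Ω.Dom, 𝒜 x = Ω.velocities x) :
    IsInvariant 𝒜 (Smax Ω Q p) := by
  rintro T - x hx ⟨c, hc, hxc, hgap⟩ t ht
  exact ⟨c, hc, h.lyap_le_of_mem_levels hreg hΩ hx hc le_rfl ht.1 ht.2 hxc, hgap⟩

theorem Feasible.isUltimatelyBounded (h : Feasible Ω Q p) [Finite κ]
    (hreg : IsRegularInclusion 𝒜) (hΩ : ∀ x ∈ Ω.Dom, 𝒜 x = Ω.velocities x) :
    IsUltimatelyBounded 𝒜 (Smax Ω Q p) (Smin Ω Q p) := by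
  intro B hB hBb
  obtain ⟨M, hM⟩ : ∃ M, ∀ y ∈ B, Q.lyap p y ≤ M := by
    obtain ⟨K, hK⟩ := h.exists_lipschitzWith_lyap
    obtain ⟨M, hM⟩ := (hK.isBounded_image hBb).bddAbove
    exact ⟨M, fun y hy => hM (mem_image_of_mem _ hy)⟩
  -- At rate 1, time `M` would bring `V` from at most `M` down to at most 0, below every level `b >
  -- 0`.
  refine ⟨max M 0, le_max_right _ _, fun T _ x hx hx0 t ht b hb => ?_⟩
  obtain ⟨c, hc, hxc, hgap⟩ := hB hx0
  have ht0 : 0 ≤ t := (le_max_right _ _).trans ht.1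
  have hle : ∀ s ∈ Icc 0 t, Q.lyap p (x s) ≤ c := fun s hs =>
    h.lyap_le_of_mem_levels hreg hΩ hx hc le_rfl hs.1 (hs.2.trans ht.2) hxc
  by_contra! hlt
  -- Invariance of `{V ≤ b}` backwards: a solution above `b` at time `t` was above it throughout.
  have hgt : ∀ s ∈ Icc 0 t, b < Q.lyap p (x s) := fun s hs => by
    by_contra! hsb
    exact hlt.not_ge (h.lyap_le_of_mem_levels hreg hΩ hx hb hs.1 hs.2 ht.2 hsb)
  have hbc : b ≤ c := hlt.le.trans (hle t (right_mem_Icc.2 ht0))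
  -- `V (x s)` stays in `[b, c]`, which has no gap, so `x s` lies in the domain and rate 1 applies.
  have hdec := h.lyap_le_of_dotProduct_le hx le_rfl ht0 ht.2 (δ := -1) fun s hs w hw j hj => by
    have hs' := Ioo_subset_Icc_self hs
    have hlev := hgap b hb hbc ⟨(hgt s hs').le, hle s hs'⟩
    rw [hΩ _ (hlev.2 rfl)] at hw
    exact h.dotProduct_velocity_le (h.ne_zero_of_lyap_pos hlev.1) hj hw
  have := (le_max_left _ _).trans ht.1
  linarith [hM _ hx0, hb.1]

/-! ### Stability of the origin -/

/-- If the origin is interior to the domain, all small positive numbers are levels. -/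
theorem Feasible.exists_Ioc_subset_levels (h : Feasible Ω Q p) [Finite κ]
    (h0 : 0 ∈ interior Ω.Dom) : ∃ c > 0, Ioc 0 c ⊆ levels Ω Q p := by
  obtain ⟨c, hc, hsub⟩ := h.exists_sublevel_subset (mem_interior_iff_mem_nhds.1 h0)
  exact ⟨c, hc, fun b hb => ⟨hb.1, fun y hy => hsub ((le_of_eq hy).trans hb.2)⟩⟩

theorem Feasible.Smin_eq_singleton (h : Feasible Ω Q p) [Finite κ]
    (h0 : 0 ∈ interior Ω.Dom) : Smin Ω Q p = {0} := by
  obtain ⟨c, hc, hsub⟩ := h.exists_Ioc_subset_levels h0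
  refine Subset.antisymm (fun y hy => ?_) ?_
  · by_contra hy0
    have hpos := h.lyap_pos hy0
    have := hy (min c (Q.lyap p y / 2)) (hsub ⟨by positivity, min_le_left _ _⟩)
    linarith [min_le_right c (Q.lyap p y / 2)]
  · rintro _ rfl b hb
    rw [h.lyap_zero]
    exact hb.1.le

theorem Feasible.Smax_mem_nhds (h : Feasible Ω Q p) [Finite κ]
    (h0 : 0 ∈ interior Ω.Dom) : Smax Ω Q p ∈ 𝓝 0 := by
  obtain ⟨c, hc, hsub⟩ := h.exists_Ioc_subset_levels h0
  filter_upwards [h.sublevel_mem_nhds hc] with y hy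
  exact ⟨c, hsub ⟨hc, le_rfl⟩, hy, fun b hb _ =>
    (Icc_subset_Ioc_iff ‹_›).2 ⟨hb.1, le_rfl⟩ |>.trans hsub⟩

/-- The origin is an equilibrium: otherwise a linear functional that is positive on `𝒜 0` would
increase along a velocity at its maximum over a small sublevel set of `V`. -/
theorem Feasible.zero_mem (h : Feasible Ω Q p) [Finite κ]
    (hreg : IsRegularInclusion 𝒜) (hΩ : ∀ x ∈ Ω.Dom, 𝒜 x = Ω.velocities x)
    (h0 : 0 ∈ interior Ω.Dom) : (0 : Fin n → ℝ) ∈ 𝒜 0 := by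
  by_contra hnot
  obtain ⟨ξ, u, hu0, hu⟩ := geometric_hahn_banach_point_closed (hreg.convex 0)
    (hreg.isCompact 0).isClosed hnot
  rw [map_zero] at hu0
  have hev := hreg.usc.forall_isOpen 0 {w | 0 < ξ w}
    (isOpen_lt continuous_const ξ.continuous) fun w hw => hu0.trans (hu w hw)
  obtain ⟨c, hc, hsub⟩ := h.exists_sublevel_subset
    (inter_mem hev (mem_interior_iff_mem_nhds.1 h0))
  obtain ⟨α, -, hball⟩ := h.sublevel_subset_closedBall
  have hcpt : IsCompact {y | Q.lyap p y ≤ c} :=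
    (isCompact_closedBall 0 (c / α)).of_isClosed_subset
      (isClosed_le h.continuous_lyap continuous_const) (hball c)
  obtain ⟨y, hy, hmax⟩ := hcpt.exists_isMaxOn ⟨0, by simpa [h.lyap_zero] using hc.le⟩
    ξ.continuous.continuousOn
  have hstep : ∀ z w : Fin n → ℝ, Tendsto (fun r : ℝ => z + r • w) (𝓝[>] 0) (𝓝 z) := fun z w => by
    have : Continuous fun r : ℝ => z + r • w := by fun_prop
    simpa using (this.tendsto 0).mono_left nhdsWithin_le_nhds
  obtain ⟨w₀, hw₀⟩ := hreg.nonempty 0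
  -- `V` need not decrease at 0, but 0 is interior to the sublevel set, so a small step along `w₀`
  -- stays inside and raises `ξ`.
  have hy0 : y ≠ 0 := by
    rintro rfl
    obtain ⟨r, hr, hr0⟩ := (((hstep 0 w₀).eventually (h.sublevel_mem_nhds hc)).and
      self_mem_nhdsWithin).exists
    have h1 := hmax hr
    simp only [mem_ofPred_eq, zero_add, map_smul, map_zero, smul_eq_mul] at h1
    exact h1.not_gt (mul_pos hr0 (hu0.trans (hu w₀ hw₀)))
  obtain ⟨w, hw⟩ := hreg.nonempty y
  obtain ⟨r, ⟨j, hj, hjr⟩, hr0⟩ := (((hstep y w).eventually (h.eventually_lyap_sub y)).and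
    self_mem_nhdsWithin).exists
  have hr0' : 0 < r := hr0
  have hξ : 0 < ξ w := (hsub hy).1 hw
  have hdec : p j ⬝ᵥ w ≤ -1 :=
    h.dotProduct_velocity_le hy0 hj (by rwa [← hΩ y (hsub hy).2])
  rw [add_sub_cancel_left, dotProduct_smul, smul_eq_mul] at hjr
  have hmem : Q.lyap p (y + r • w) ≤ c := by
    have : Q.lyap p y ≤ c := hy
    nlinarith
  have h1 := hmax hmem
  simp only [mem_ofPred_eq, map_add, map_smul, smul_eq_mul] at h1
  nlinarith [mul_pos hr0' hξ]

theorem Feasible.isAsymptoticallyStable (h : Feasible Ω Q p) [Finite κ]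
    (hreg : IsRegularInclusion 𝒜) (hΩ : ∀ x ∈ Ω.Dom, 𝒜 x = Ω.velocities x)
    (h0 : 0 ∈ interior Ω.Dom) : IsAsymptoticallyStable 𝒜 0 (Smax Ω Q p) where
  equilibrium := h.zero_mem hreg hΩ h0
  stable U hU := by
    obtain ⟨c, hc, hsub⟩ := h.exists_Ioc_subset_levels h0
    obtain ⟨d, hd, hdU⟩ := h.exists_sublevel_subset hU
    refine ⟨{y | Q.lyap p y ≤ min c d}, h.sublevel_mem_nhds (lt_min hc hd),
      fun T _ x hx hx0 t ht => hdU ?_⟩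
    exact (h.lyap_le_of_mem_levels hreg hΩ hx (hsub ⟨lt_min hc hd, min_le_left _ _⟩) le_rfl ht.1
      ht.2 hx0).trans (min_le_right _ _)
  mem_nhds := h.Smax_mem_nhds h0
  attractive x hx hx0 := by
    obtain ⟨τ, hτ, hb⟩ := h.isUltimatelyBounded hreg hΩ {x 0} (singleton_subset_iff.2 hx0)
      Bornology.isBounded_singleton
    -- Convergence is in finite time: after `τ` the solution lies in `Smin = {0}`.
    refine tendsto_const_nhds.congr' ?_
    filter_upwards [eventually_ge_atTop τ] with t ht
    have h1 := hb t (hτ.trans ht) x (hx t (hτ.trans ht)) rfl t ⟨ht, le_rfl⟩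
    rw [h.Smin_eq_singleton h0] at h1
    exact h1.symm

end Lyapunov

end PWA

theorem mainTheorem1 {n : ℕ} {ι κ : Type*} [Finite ι] [Finite κ]
    (Ω : PWA.System n ι) (Q : PWA.ConePartition n κ) (p : κ → Fin n → ℝ)
    (hconn : IsConnected Ω.Dom) (hco : (0 : Fin n → ℝ) ∈ convexHull ℝ Ω.Dom)
    (hfeas : PWA.Feasible Ω Q p)
    (𝒜 : (Fin n → ℝ) → Set (Fin n → ℝ)) (hreg : PWA.IsRegularInclusion 𝒜)
    (hΩ : ∀ x ∈ Ω.Dom, 𝒜 x = Ω.velocities x) :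
    PWA.IsInvariant 𝒜 (PWA.Smax Ω Q p) ∧
    PWA.IsUltimatelyBounded 𝒜 (PWA.Smax Ω Q p) (PWA.Smin Ω Q p) ∧
    ((0 : Fin n → ℝ) ∈ interior Ω.Dom →
      PWA.IsAsymptoticallyStable 𝒜 0 (PWA.Smax Ω Q p)) :=
  ⟨hfeas.isInvariant_Smax hreg hΩ, hfeas.isUltimatelyBounded hreg hΩ,
    hfeas.isAsymptoticallyStable hreg hΩ⟩
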